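/- Let $k$ be a commutative artinian ring, let $\Lambda$ be an artin $k$-algebra (a $k$-algebra that is finitely generated as a $k$-module), and let $\mathcal A=\operatorname{mod}\Lambda$ be the abelian category of finitely generated right $\Lambda$-modules. For a finite family $(\Delta_i)_i$ of objects in an abelian category, $\operatorname{Filt}(\Delta_i)_i$ denotes the full subcategory of all objects $X$ admitting a finite filtration $0=X_0\subseteq X_1\subseteq\dots\subseteq X_t=X$ in which each factor $X_s/X_{s-1}$ is isomorphic to some $\Delta_i$; it is an exact category whose admissible exact sequences are the short exact sequences of the ambient category with all three terms in it. A projective object $P$ of an abelian or exact category is a *projective generator* if for every object $X$ there is an (admissible) exact sequence $0\to N\to P^r\to X\to 0$ for some positive integer $r$. An abelian category $\mathcal A$ in which every object has a finite composition series, and which has only finitely many isomorphism classes of simple objects, is called a *highest weight category* if there are an integer $n\ge 0$ and exact sequences $0\to U_i\to P_i\to\Delta_i\to 0$ ($1\le i\le n$) in $\mathcal A$ such that $\operatorname{End}_{\mathcal A}(\Delta_i)$ is a division ring for all $i$, $\operatorname{Hom}_{\mathcal A}(\Delta_i,\Delta_j)=0$ for all $i>j$, $U_i\in\operatorname{Filt}(\Delta_{i+1},\dots,\Delta_n)$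 for all $i$, and $\bigoplus_{i=1}^nP_i$ is a projective generator of $\mathcal A$. **Theorem.** The category $\mathcal A=\operatorname{mod}\Lambda$ is a highest weight category if and only if there are an integer $n\ge 0$ and objects $\Delta_1,\dots,\Delta_n$ of $\mathcal A$ with the following properties: 1. $\operatorname{End}_{\mathcal A}(\Delta_i)$ is a division ring for all $i$; 2. $\operatorname{Hom}_{\mathcal A}(\Delta_i,\Delta_j)=0$ for all $i>j$; 3. $\operatorname{Ext}^1_{\mathcal A}(\Delta_i,\Delta_j)=0$ for all $i\ge j$; 4. some projective generator of $\operatorname{Filt}(\Delta_1,\dots,\Delta_n)$ is also a projective generator of $\mathcal A$. The same equivalence holds with (4) replaced by: (4') every projective generator of $\operatorname{Filt}(\Delta_1,\dots,\Delta_n)$ is also a projective generator of $\mathcal A$. -/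

import Mathlib

open CategoryTheory CategoryTheory.Limits

universe w v u

namespace HighestWeight

noncomputable section

attribute [local instance] Abelian.hasFiniteBiproducts

variable {C : Type u} [Category.{v} C] [Abelian C]

/-- `Filt Δ` is the full subcategory of the objects `X` that admit a finite filtration
`0 = X₀ ⊆ X₁ ⊆ ⋯ ⊆ Xₜ = X` such that each factor `Xᵢ₊₁ / Xᵢ` is isomorphic to some `Δ j`.
(The chain is indexed by `ℕ`; its terms beyond `t` carry no information.) -/
def Filt {ι : Type w} (Δ : ι → C) : ObjectProperty C := fun X =>
  ∃ (t : ℕ) (F : ℕ →o Subobject X), F 0 = ⊥ ∧ F t = ⊤ ∧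
    ∀ i < t, ∃ j : ι,
      Nonempty (cokernel (Subobject.ofLE (F i) (F (i + 1)) (F.monotone i.le_succ)) ≅ Δ j)

/-- `X` has a finite composition series: a finite filtration with simple factors. -/
def HasCompositionSeries (X : C) : Prop :=
  Filt (fun S : {S : C // Simple S} => S.1) X

/-- The endomorphism ring of `X` is a division ring. -/
def EndIsDivisionRing (X : C) : Prop :=
  Nontrivial (End X) ∧ ∀ f : End X, f ≠ 0 → IsUnit f

/-- `Ext¹(X, Y) = 0` in the abelian category `C`. -/
def ExtOneVanishes (X Y : C) : Prop :=
  letI : HasExt.{max u v} C := HasExt.standard C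
  Subsingleton (Abelian.Ext X Y 1)

/-- `P` is a projective generator of the abelian category `C`: it is projective, and every object
`X` fits into an exact sequence `0 ⟶ N ⟶ Pʳ ⟶ X ⟶ 0` with `r` a positive integer. -/
def IsProjectiveGenerator (P : C) : Prop :=
  Projective P ∧
    ∀ X : C, ∃ r : ℕ, 0 < r ∧ ∃ (N : C) (i : N ⟶ ⨁ fun _ : Fin r => P)
      (p : (⨁ fun _ : Fin r => P) ⟶ X) (h : i ≫ p = 0), (ShortComplex.mk i p h).ShortExact

/-- `P` is a projective generator of the full, extension closed subcategory `E` of `C`, regarded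
as an exact category: the admissible exact sequences of `E` are the short exact sequences of `C`
all of whose terms belong to `E`. -/
def IsProjectiveGeneratorOf (E : ObjectProperty C) (P : C) : Prop :=
  E P ∧
    (∀ S : ShortComplex C, S.ShortExact → E S.X₁ → E S.X₂ → E S.X₃ →
      ∀ f : P ⟶ S.X₃, ∃ g : P ⟶ S.X₂, g ≫ S.g = f) ∧
    ∀ X : C, E X → ∃ r : ℕ, 0 < r ∧ ∃ (N : C) (i : N ⟶ ⨁ fun _ : Fin r => P)
      (p : (⨁ fun _ : Fin r => P) ⟶ X) (h : i ≫ p = 0),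
        E N ∧ (ShortComplex.mk i p h).ShortExact

variable (C) in
/-- The abelian category `C` is a highest weight category: it is a length category with only
finitely many isomorphism classes of simple objects, and there are finitely many exact sequences
`0 ⟶ Uᵢ ⟶ Pᵢ ⟶ Δᵢ ⟶ 0` satisfying the four conditions below. Here `Uᵢ`, `Pᵢ`, `Δᵢ` are the
terms `(S i).X₁`, `(S i).X₂`, `(S i).X₃` of the short complex `S i`. -/
structure IsHighestWeightCategory : Prop where
  finite_length : ∀ X : C, HasCompositionSeries X
  finite_simples : ∃ (m : ℕ) (T : Fin m → C), ∀ X : C, Simple X → ∃ i, Nonempty (X ≅ T i)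
  exists_sequences : ∃ (n : ℕ) (S : Fin n → ShortComplex C),
    (∀ i, (S i).ShortExact) ∧
    (∀ i, EndIsDivisionRing (S i).X₃) ∧
    (∀ i j, j < i → ∀ f : (S i).X₃ ⟶ (S j).X₃, f = 0) ∧
    (∀ i, Filt (fun j : {j : Fin n // i < j} => (S j).X₃) (S i).X₁) ∧
    IsProjectiveGenerator (⨁ fun i => (S i).X₂)

end

/-- The opposite ring of an artin algebra is noetherian, so that the finitely generated right
modules form an abelian category. -/
theorem isNoetherianRing_op (k : Type w) (Λ : Type u) [CommRing k] [IsArtinianRing k] [Ring Λ]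
    [Algebra k Λ] [Module.Finite k Λ] : IsNoetherianRing Λᵐᵒᵖ :=
  IsNoetherianRing.of_finite k Λᵐᵒᵖ

end HighestWeight

/-! ### Filtered objects: iterated extensions versus chains of subobjects. -/

namespace HighestWeight

open scoped ZeroObject

noncomputable section

attribute [local instance] Abelian.hasFiniteBiproducts

variable {C : Type u} [Category.{v} C] [Abelian C]

/-! Given sequences `0 → Uᵢ → Pᵢ → Δᵢ → 0` of a highest weight category, `Pᵢ` is projective as a
summand of a projective. Since `Uᵢ` is filtered by `Δₗ` with `l > i`, it has no nonzero map to `Δⱼ`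
for `j ≤ i`, so `Ext¹(Δᵢ, Δⱼ)` embeds into `Ext¹(Pᵢ, Δⱼ) = 0` (`extOneVanishes_of_sequences`).

Conversely, start from `Δᵢ` and form universal extensions by powers of `Δᵢ₊₁, …, Δₙ` in turn
(`exists_universal_extension`). Each step kills one more `Ext¹(-, Δₖ)`, and the earlier vanishing
survives because `Ext¹(Δₖ, Δⱼ) = 0` for `j ≤ k`. The outcome is an epimorphism `Pᵢ → Δᵢ` with kernel
filtered by later `Δⱼ` and `Ext¹(Pᵢ, Δⱼ) = 0` for all `j` (`exists_epi_of_extOneVanishes`). The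
powers are finite because Hom modules over an artin algebra are finitely generated over `k`.

In both directions `⨁ Pᵢ` is a projective generator of `Filt Δ`
(`isProjectiveGeneratorOf_biproduct`). Two projective generators of `Filt Δ` are summands of powers
of each other, so all or none of them are projective generators of the ambient category
(`IsProjectiveGenerator.of_filt`). This makes (4) and (4') interchangeable. -/

/-- The objects obtained from zero objects by finitely many extensions by the objects `Δ j`. -/
inductive IsFiltered {ι : Type w} (Δ : ι → C) : C → Prop
  | of_isZero {X : C} (h : IsZero X) : IsFiltered Δ X
  | of_shortExact {S : ShortComplex C} (hS : S.ShortExact) (h : IsFiltered Δ S.X₁) (j : ι)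
      (e : Nonempty (S.X₃ ≅ Δ j)) : IsFiltered Δ S.X₂

lemma shortExact_cokernel {X Y : C} (f : X ⟶ Y) [Mono f] :
    (ShortComplex.mk f (cokernel.π f) (cokernel.condition f)).ShortExact :=
  .mk' (ShortComplex.exact_cokernel f) inferInstance inferInstance

lemma shortExact_kernel {X Y : C} (f : X ⟶ Y) [Epi f] :
    (ShortComplex.mk (kernel.ι f) f (kernel.condition f)).ShortExact :=
  .mk' (ShortComplex.exact_kernel f) inferInstance inferInstance

section

variable {ι : Type w} {Δ : ι → C}

lemma IsFiltered.of_iso {X Y : C} (h : IsFiltered Δ X) (e : X ≅ Y) : IsFiltered Δ Y := by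
  cases h with
  | of_isZero h => exact .of_isZero (h.of_iso e.symm)
  | @of_shortExact S hS h j e' =>
    let T : ShortComplex C := .mk (S.f ≫ e.hom) (e.inv ≫ S.g) (by simp)
    have hT : T.ShortExact := ShortComplex.shortExact_of_iso
      (ShortComplex.isoMk (S₁ := S) (S₂ := T) (Iso.refl _) e (Iso.refl _) (by simp [T])
        (by simp [T])) hS
    exact .of_shortExact (S := T) hT h j e'

/-- Filtered objects are closed under extensions. -/
lemma IsFiltered.of_extension {X Y : C} (hY : IsFiltered Δ Y) (hX : IsFiltered Δ X) {Z : C}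
    (f : X ⟶ Z) (g : Z ⟶ Y) (w : f ≫ g = 0) (hS : (ShortComplex.mk f g w).ShortExact) :
    IsFiltered Δ Z := by
  induction hY generalizing Z with
  | @of_isZero Y h =>
    have : IsIso f := (ShortComplex.ShortExact.isIso_f_iff hS).2 h
    exact hX.of_iso (asIso f)
  | @of_shortExact T hT h j e ih =>
    have := hS.mono_f
    have := hS.epi_g
    have := hT.mono_f
    have := hT.epi_g
    dsimp at *
    -- `kernel (g ≫ T.g)` is the preimage of `T.X₁` in `Z`: the quotient by it is `T.X₃`, and it is
    -- itself an extension of `T.X₁` by `X`, to which the induction hypothesis applies.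
    have h1 : (ShortComplex.mk (kernel.ι (g ≫ T.g)) (g ≫ T.g)
      (kernel.condition _)).ShortExact := shortExact_kernel _
    refine .of_shortExact h1 ?_ j e
    let a : X ⟶ kernel (g ≫ T.g) := kernel.lift _ f (by rw [← Category.assoc, w, zero_comp])
    let b : kernel (g ≫ T.g) ⟶ T.X₁ := hT.exact.lift (kernel.ι _ ≫ g) (by simp)
    have ha : a ≫ kernel.ι _ = f := kernel.lift_ι _ _ _
    have hb : b ≫ T.f = kernel.ι _ ≫ g := hT.exact.lift_f _ _
    have hab : a ≫ b = 0 := by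
      rw [← cancel_mono T.f, Category.assoc, hb, ← Category.assoc, ha, w, zero_comp]
    have : Mono a := mono_of_mono_fac ha
    -- As a base change of the epimorphism `g`, `b` is epi.
    have hpb : IsPullback (kernel.ι (g ≫ T.g)) b g T.f := by
      refine ⟨⟨hb.symm⟩, ⟨PullbackCone.IsLimit.mk _
        (fun s => kernel.lift _ s.fst (by
          rw [← Category.assoc, s.condition, Category.assoc, T.zero, comp_zero]))
        (fun s => by simp) (fun s => ?_) (fun s m h1 _ => ?_)⟩⟩
      · rw [← cancel_mono T.f, Category.assoc, hb, ← Category.assoc, kernel.lift_ι, s.condition]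
      · rw [← cancel_mono (kernel.ι _), kernel.lift_ι, h1]
    have : Epi b := by
      have := Abelian.epi_snd_of_isLimit (f := g) (g := T.f) hpb.isLimit
      exact this
    refine ih a b hab (.mk' ?_ inferInstance inferInstance)
    refine ShortComplex.exact_of_f_is_kernel _ (KernelFork.IsLimit.ofι _ _
      (fun x hx => hS.exact.lift (x ≫ kernel.ι _) ?_) (fun x hx => ?_) (fun x hx m hm => ?_))
    · dsimp at hx ⊢
      rw [Category.assoc, ← hb, ← Category.assoc, hx, zero_comp]
    · rw [← cancel_mono (kernel.ι _)]
      dsimp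
      rw [Category.assoc, ha]
      exact hS.exact.lift_f _ _
    · rw [← cancel_mono f]
      refine Eq.trans ?_ (hS.exact.lift_f _ _).symm
      dsimp at hm
      dsimp only
      rw [← hm, Category.assoc, ha]

lemma IsFiltered.of_shortExact' {S : ShortComplex C} (hS : S.ShortExact)
    (h₁ : IsFiltered Δ S.X₁) (h₃ : IsFiltered Δ S.X₃) : IsFiltered Δ S.X₂ :=
  h₃.of_extension h₁ S.f S.g S.zero hS

lemma IsFiltered.self (j : ι) : IsFiltered Δ (Δ j) := by
  refine .of_shortExact (S := .mk (0 : (0 : C) ⟶ Δ j) (𝟙 (Δ j)) (by simp)) ?_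
    (.of_isZero (isZero_zero C)) j ⟨Iso.refl _⟩
  exact .mk' ((ShortComplex.exact_iff_mono _ rfl).2 (by dsimp; infer_instance))
    ⟨fun _ _ _ => (isZero_zero C).eq_of_tgt _ _⟩ (by dsimp; infer_instance)

lemma shortExact_biprod (X Y : C) :
    (ShortComplex.mk (biprod.inl : X ⟶ X ⊞ Y) biprod.snd (by simp)).ShortExact :=
  (ShortComplex.Splitting.mk (S := .mk (biprod.inl : X ⟶ X ⊞ Y) biprod.snd (by simp))
    biprod.fst biprod.inr (by simp) (by simp) (by simp)).shortExact

lemma IsFiltered.biprod {X Y : C} (hX : IsFiltered Δ X) (hY : IsFiltered Δ Y) :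
    IsFiltered Δ (X ⊞ Y) :=
  .of_shortExact' (shortExact_biprod X Y) hX hY

lemma IsFiltered.mono {κ : Type*} {Δ' : κ → C} {X : C} (h : IsFiltered Δ X)
    (hΔ : ∀ i, IsFiltered Δ' (Δ i)) : IsFiltered Δ' X := by
  induction h with
  | of_isZero h => exact .of_isZero h
  | of_shortExact hS _ j e ih => exact .of_shortExact' hS ih ((hΔ j).of_iso e.some.symm)

/-- The objects of `Filt Δ` are filtered. -/
lemma Filt.isFiltered {X : C} (h : Filt Δ X) : IsFiltered Δ X := by
  obtain ⟨t, F, h0, ht, hF⟩ := h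
  have key : ∀ i ≤ t, IsFiltered Δ (F i : C) := by
    intro i
    induction i with
    | zero =>
      intro _
      rw [h0]
      exact .of_isZero ((isZero_zero C).of_iso Subobject.botCoeIsoZero)
    | succ i ih =>
      intro hi
      obtain ⟨j, e⟩ := hF i (by omega)
      exact .of_shortExact (shortExact_cokernel _) (ih (by omega)) j e
  have := key t le_rfl
  rw [ht] at this
  exact this.of_iso (asIso (⊤ : Subobject X).arrow)

/-- Lets the factors of a chain be computed on chosen representatives of the subobjects. -/
lemma nonempty_cokernel_ofLE_iso {X : C} {A B : Subobject X} (h : A ≤ B) {A' B' : C}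
    (a : A' ⟶ X) (b : B' ⟶ X) [Mono a] [Mono b] (hA : A = Subobject.mk a)
    (hB : B = Subobject.mk b) (g : A' ⟶ B') (hg : g ≫ b = a) :
    Nonempty (cokernel (Subobject.ofLE A B h) ≅ cokernel g) := by
  subst hA hB
  refine ⟨cokernel.mapIso _ _ (Subobject.underlyingIso a) (Subobject.underlyingIso b) ?_⟩
  rw [← cancel_mono b]
  simp [hg]

/-- An extension is handled by pushing the chain of the subobject forward along the inclusion and
appending `⊤`; the only new factor is the quotient. -/
lemma IsFiltered.filt {X : C} (h : IsFiltered Δ X) : Filt Δ X := by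
  induction h with
  | @of_isZero X h =>
    refine ⟨0, ⟨fun _ => ⊥, fun _ _ _ => le_rfl⟩, rfl, ?_, by simp⟩
    change (⊥ : Subobject X) = ⊤
    rw [Subobject.bot_eq_zero]
    refine (Subobject.isIso_iff_mk_eq_top _).1 ?_
    exact ⟨0, (isZero_zero C).eq_of_src _ _, h.eq_of_src _ _⟩
  | @of_shortExact S hS _ j e ih =>
    obtain ⟨t, F, h0, ht, hF⟩ := ih
    have := hS.mono_f
    have := hS.epi_g
    let F' : ℕ →o Subobject S.X₂ :=
      ⟨fun i => if i ≤ t then (Subobject.map S.f).obj (F i) else ⊤, fun i i' hi => by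
        by_cases hi' : i' ≤ t
        · simp only [hi', hi.trans hi', if_true]
          exact (Subobject.map S.f).monotone (F.monotone hi)
        · simp [hi']⟩
    have hF' : ∀ i ≤ t, F' i = Subobject.mk ((F i).arrow ≫ S.f) := by
      intro i hi
      change (if i ≤ t then _ else _) = _
      rw [if_pos hi]
      conv_lhs => rw [← Subobject.mk_arrow (F i)]
      rw [Subobject.map_mk]
    have hF'' : F' (t + 1) = Subobject.mk (𝟙 S.X₂) := by
      change (if t + 1 ≤ t then _ else _) = _
      rw [if_neg (by omega)]
      rfl
    refine ⟨t + 1, F', ?_, ?_, fun i hi => ?_⟩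
    · change (if 0 ≤ t then (Subobject.map S.f).obj (F 0) else ⊤) = ⊥
      rw [if_pos (Nat.zero_le _), h0, Subobject.map_bot]
    · rw [hF'']; rfl
    · by_cases hit : i < t
      · obtain ⟨j, ⟨e⟩⟩ := hF i hit
        obtain ⟨e'⟩ := nonempty_cokernel_ofLE_iso (F'.monotone i.le_succ) _ _
          (hF' i hit.le) (hF' (i + 1) hit) (Subobject.ofLE (F i) (F (i + 1))
            (F.monotone i.le_succ)) (by simp)
        exact ⟨j, ⟨e' ≪≫ e⟩⟩
      · obtain rfl : i = t := by omega
        have hFi : F' i = Subobject.mk S.f := by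
          rw [hF' i le_rfl, ht]
          exact Subobject.mk_eq_mk_of_comm _ S.f (asIso (⊤ : Subobject S.X₁).arrow) (by simp)
        obtain ⟨e'⟩ := nonempty_cokernel_ofLE_iso (F'.monotone i.le_succ) S.f (𝟙 _) hFi hF''
          S.f (by simp)
        exact ⟨j, ⟨e' ≪≫ (IsColimit.coconePointUniqueUpToIso (colimit.isColimit _)
          hS.gIsCokernel) ≪≫ e.some⟩⟩

lemma filt_iff {X : C} : Filt Δ X ↔ IsFiltered Δ X :=
  ⟨Filt.isFiltered, IsFiltered.filt⟩

end

/-! ### Kernels of morphisms of short exact sequences; finite biproducts. -/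

/-- A morphism of short exact sequences that is an epimorphism on the first terms induces a short
exact sequence of kernels. -/
lemma exists_shortExact_kernel {S T : ShortComplex C} (hS : S.ShortExact) (hT : T.ShortExact)
    (φ : S ⟶ T) [Epi φ.τ₁] : ∃ K : ShortComplex C, K.ShortExact ∧
      Nonempty (K.X₁ ≅ kernel φ.τ₁) ∧ Nonempty (K.X₂ ≅ kernel φ.τ₂) ∧
      Nonempty (K.X₃ ≅ kernel φ.τ₃) := by
  let I : ShortComplex.SnakeInput C :=
    { L₀ := kernel φ
      L₁ := S
      L₂ := T
      L₃ := cokernel φ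
      v₀₁ := kernel.ι φ
      v₁₂ := φ
      v₂₃ := cokernel.π φ
      w₀₂ := kernel.condition φ
      w₁₃ := cokernel.condition φ
      h₀ := kernelIsKernel φ
      h₃ := cokernelIsCokernel φ
      L₁_exact := hS.exact
      epi_L₁_g := hS.epi_g
      L₂_exact := hT.exact
      mono_L₂_f := hT.mono_f }
  have : Mono I.L₁.f := hS.mono_f
  have : Epi I.v₁₂.τ₁ := ‹Epi φ.τ₁›
  -- The first cokernel, target of the connecting map, vanishes; hence the row of kernels ends in an
  -- epimorphism.
  have h0 : I.v₂₃.τ₁ = 0 := by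
    rw [← cancel_epi I.v₁₂.τ₁, I.w₁₃_τ₁, comp_zero]
  have := I.epi_v₂₃_τ₁
  have h1 : IsZero I.L₃.X₁ := by
    rw [IsZero.iff_id_eq_zero, ← cancel_epi I.v₂₃.τ₁, h0, zero_comp, zero_comp]
  have : Epi I.L₀.g := I.L₁'_exact.epi_f (h1.eq_of_tgt _ _)
  refine ⟨I.L₀, ShortComplex.ShortExact.mk' I.L₀_exact I.mono_L₀_f this, ⟨?_⟩, ⟨?_⟩, ⟨?_⟩⟩
  · exact I.h₀τ₁.conePointUniqueUpToIso (limit.isLimit _)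
  · exact I.h₀τ₂.conePointUniqueUpToIso (limit.isLimit _)
  · exact I.h₀τ₃.conePointUniqueUpToIso (limit.isLimit _)

lemma projective_biproduct {J : Type*} [Finite J] {f : J → C} (hf : ∀ j, Projective (f j)) :
    Projective (⨁ f) :=
  ⟨fun g e _ => ⟨biproduct.desc fun j => Projective.factorThru (biproduct.ι f j ≫ g) e, by
    ext; simp⟩⟩

/-- A finite biproduct splits off its last summand. -/
def biproductFinSuccIso {n : ℕ} (f : Fin (n + 1) → C) :
    ⨁ f ≅ (⨁ fun i : Fin n => f i.castSucc) ⊞ f (Fin.last n) where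
  hom := biprod.lift (biproduct.lift fun i => biproduct.π f i.castSucc) (biproduct.π f _)
  inv := biprod.desc (biproduct.desc fun i => biproduct.ι f i.castSucc) (biproduct.ι f _)
  hom_inv_id := by
    refine biproduct.hom_ext' _ _ fun i => biproduct.hom_ext _ _ fun j => ?_
    rw [biprod.lift_desc, biproduct.lift_desc]
    simp only [Preadditive.comp_add, Preadditive.add_comp, Preadditive.comp_sum,
      Preadditive.sum_comp, Category.assoc, Category.comp_id]
    have := congrArg (fun g => biproduct.ι f i ≫ g ≫ biproduct.π f j) (biproduct.total (f := f))
    rw [Fin.sum_univ_castSucc] at this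
    simpa [Preadditive.comp_add, Preadditive.add_comp, Preadditive.comp_sum,
      Preadditive.sum_comp] using this
  inv_hom_id := by
    have h (i : Fin n) : i.castSucc ≠ Fin.last n := (Fin.castSucc_lt_last i).ne
    ext i j
    · simp [biproduct.ι_π]
    · simp [biproduct.ι_π_ne _ (h i)]
    · simp [biproduct.ι_π_ne _ (h _).symm]
    · simp

/-! ### Covers with filtered kernel and projective generators of `Filt Δ`. -/

section

variable {ι : Type w} {Δ : ι → C}

lemma IsFiltered.biproduct_fin {n : ℕ} {f : Fin n → C} (hf : ∀ i, IsFiltered Δ (f i)) :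
    IsFiltered Δ (⨁ f) := by
  induction n with
  | zero =>
    refine .of_isZero ((IsZero.iff_id_eq_zero _).2 ?_)
    ext i
    exact i.elim0
  | succ n ih =>
    exact ((ih fun i => hf i.castSucc).biprod (hf _)).of_iso (biproductFinSuccIso f).symm

lemma IsFiltered.biproduct {J : Type} [Finite J] {f : J → C} (hf : ∀ i, IsFiltered Δ (f i)) :
    IsFiltered Δ (⨁ f) := by
  obtain ⟨n, ⟨e⟩⟩ := Finite.exists_equiv_fin J
  exact (IsFiltered.biproduct_fin (f := fun i => f (e.symm i)) fun i => hf _).of_iso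
    (biproduct.whiskerEquiv e.symm fun _ => Iso.refl _)

/-- The kernel of a composition of epimorphisms with filtered kernels is filtered. -/
lemma IsFiltered.kernel_comp {X Y Z : C} (f : X ⟶ Y) (g : Y ⟶ Z) [Epi f] [Epi g]
    (hf : IsFiltered Δ (kernel f)) (hg : IsFiltered Δ (kernel g)) :
    IsFiltered Δ (kernel (f ≫ g)) := by
  -- Mapping `0 → kernel f → X → Y → 0` to `0 → 0 → Z → Z → 0` exhibits `kernel (f ≫ g)` as an
  -- extension of `kernel g` by `kernel f`.
  let T : ShortComplex C := .mk (0 : 0 ⟶ Z) (𝟙 Z) (by simp)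
  have hT : T.ShortExact := .mk' ((ShortComplex.exact_iff_mono _ rfl).2 (by dsimp [T]; infer_instance))
    ⟨fun _ _ _ => (isZero_zero C).eq_of_tgt _ _⟩ (by dsimp [T]; infer_instance)
  let φ : ShortComplex.mk (kernel.ι f) f (kernel.condition f) ⟶ T :=
    { τ₁ := 0, τ₂ := f ≫ g, τ₃ := g, comm₁₂ := by simp [T], comm₂₃ := by simp [T] }
  have : Epi φ.τ₁ := ⟨fun _ _ _ => (isZero_zero C).eq_of_src _ _⟩
  obtain ⟨K, hK, ⟨e₁⟩, ⟨e₂⟩, ⟨e₃⟩⟩ := exists_shortExact_kernel (shortExact_kernel f) hT φ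
  have h0 : φ.τ₁ = 0 := rfl
  have e : kernel φ.τ₁ ≅ kernel f :=
    kernelIsoOfEq h0 ≪≫ kernelZeroIsoSource
  exact (IsFiltered.of_shortExact' hK (hf.of_iso (e₁ ≪≫ e).symm)
    (hg.of_iso e₃.symm)).of_iso e₂

variable (Δ) in
/-- `P` has the lifting property with respect to the admissible exact sequences of `Filt Δ`. -/
def LiftsAgainst (P : C) : Prop :=
  ∀ S : ShortComplex C, S.ShortExact → IsFiltered Δ S.X₁ → IsFiltered Δ S.X₂ →
    IsFiltered Δ S.X₃ → ∀ f : P ⟶ S.X₃, ∃ g : P ⟶ S.X₂, g ≫ S.g = f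

variable (Δ) in
/-- `X` is the target of an epimorphism from a positive power of `P` with filtered kernel. -/
def HasCover (P X : C) : Prop :=
  ∃ r : ℕ, 0 < r ∧ ∃ p : (⨁ fun _ : Fin r => P) ⟶ X, Epi p ∧ IsFiltered Δ (kernel p)

lemma isProjectiveGeneratorOf_filt_iff {P : C} : IsProjectiveGeneratorOf (Filt Δ) P ↔
    IsFiltered Δ P ∧ LiftsAgainst Δ P ∧ ∀ X, IsFiltered Δ X → HasCover Δ P X := by
  simp only [IsProjectiveGeneratorOf, LiftsAgainst, HasCover, filt_iff]
  refine and_congr_right fun _ => and_congr_right fun _ => forall₂_congr fun X _ => ?_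
  refine exists_congr fun r => and_congr_right fun _ => ?_
  constructor
  · rintro ⟨N, i, p, h, hN, hS⟩
    exact ⟨p, hS.epi_g, hN.of_iso (hS.fIsKernel.conePointUniqueUpToIso (limit.isLimit _))⟩
  · rintro ⟨p, _, h⟩
    exact ⟨_, _, p, kernel.condition p, h, shortExact_kernel p⟩

lemma isProjectiveGenerator_iff {P : C} : IsProjectiveGenerator P ↔
    Projective P ∧ ∀ X : C, ∃ r : ℕ, 0 < r ∧ ∃ p : (⨁ fun _ : Fin r => P) ⟶ X, Epi p := by
  refine and_congr_right fun _ => forall_congr' fun X => ?_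
  refine exists_congr fun r => and_congr_right fun _ => ?_
  constructor
  · rintro ⟨N, i, p, h, hS⟩
    exact ⟨p, hS.epi_g⟩
  · rintro ⟨p, _⟩
    exact ⟨_, _, p, kernel.condition p, shortExact_kernel p⟩

/-- If `P` lifts against the admissible exact sequences and covers each `Δ j`, then `P` covers all
filtered objects. -/
lemma HasCover.of_isFiltered {P X : C} (hP : IsFiltered Δ P) (hl : LiftsAgainst Δ P)
    (hc : ∀ j, ∃ q : P ⟶ Δ j, Epi q ∧ IsFiltered Δ (kernel q)) (hX : IsFiltered Δ X) :
    HasCover Δ P X := by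
  induction hX with
  | @of_isZero X h =>
    -- The exponent must be positive, so a zero object is covered by `P` itself, with kernel `P`.
    refine ⟨1, one_pos, 0, ⟨fun _ _ _ => h.eq_of_src _ _⟩, ?_⟩
    exact (IsFiltered.biproduct fun _ => hP).of_iso kernelZeroIsoSource.symm
  | @of_shortExact S hS h j e ih =>
    obtain ⟨r, hr, p, _, hp⟩ := ih
    obtain ⟨q, _, hq⟩ := hc j
    obtain ⟨e⟩ := e
    have hS₃ : IsFiltered Δ S.X₃ := (IsFiltered.self j).of_iso e.symm
    -- Horseshoe argument: the cover of the quotient lifts to the middle term and is added to the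
    -- cover of the subobject.
    obtain ⟨q', hq'⟩ := hl S hS h (.of_shortExact hS h j ⟨e⟩) hS₃ (q ≫ e.inv)
    let T : ShortComplex C := .mk (biprod.inl : (⨁ fun _ : Fin r => P) ⟶ _ ⊞ P) biprod.snd (by simp)
    have hT : T.ShortExact := shortExact_biprod _ _
    let φ : T ⟶ S :=
      { τ₁ := p, τ₂ := biprod.desc (p ≫ S.f) q', τ₃ := q ≫ e.inv
        comm₁₂ := by simp [T], comm₂₃ := by dsimp [T]; ext <;> simp [hq'] }
    have : Epi φ.τ₁ := ‹Epi p›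
    have : Epi φ.τ₃ := by dsimp [φ]; infer_instance
    have := hS.epi_g
    have := hT.epi_g
    have : Epi φ.τ₂ := ShortComplex.epi_τ₂_of_exact_of_epi φ hS.exact
    obtain ⟨K, hK, ⟨e₁⟩, ⟨e₂⟩, ⟨e₃⟩⟩ := exists_shortExact_kernel hT hS φ
    refine ⟨r + 1, r.succ_pos, (biproductFinSuccIso _).hom ≫ φ.τ₂, inferInstance, ?_⟩
    refine IsFiltered.of_iso ?_ (kernelIsIsoComp _ _).symm
    refine (IsFiltered.of_shortExact' hK (hp.of_iso e₁.symm) (hq.of_iso ?_)).of_iso e₂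
    exact (kernelCompMono q e.inv).symm ≪≫ e₃.symm

lemma LiftsAgainst.biproduct {J : Type} [Finite J] {f : J → C} (h : ∀ i, LiftsAgainst Δ (f i)) :
    LiftsAgainst Δ (⨁ f) := by
  intro S hS h₁ h₂ h₃ g
  choose k hk using fun i => h i S hS h₁ h₂ h₃ (biproduct.ι f i ≫ g)
  exact ⟨biproduct.desc k, by ext i; simp [hk]⟩

/-- A projective generator of `Filt Δ` is one of `C` if this holds for some other projective
generator of `Filt Δ`. -/
lemma IsProjectiveGenerator.of_filt {P Q : C} (hP : IsProjectiveGeneratorOf (Filt Δ) P)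
    (hQ : IsProjectiveGeneratorOf (Filt Δ) Q) (h : IsProjectiveGenerator P) :
    IsProjectiveGenerator Q := by
  rw [isProjectiveGeneratorOf_filt_iff] at hP hQ
  rw [isProjectiveGenerator_iff] at h ⊢
  obtain ⟨_, h⟩ := h
  refine ⟨?_, fun X => ?_⟩
  -- The cover `Pʳ → Q` is admissible, so the lifting property of `Q` splits it.
  · obtain ⟨r, _, p, _, hp⟩ := hP.2.2 Q hQ.1
    obtain ⟨s, hs⟩ := hQ.2.1 _ (shortExact_kernel p) hp
      (IsFiltered.biproduct fun _ => hP.1) hQ.1 (𝟙 Q)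
    have : Projective (⨁ fun _ : Fin r => P) := projective_biproduct fun _ => ‹_›
    exact (Retract.mk s p hs : Retract Q (⨁ fun _ : Fin r => P)).projective
  -- Compose `Qʳˢ ≅ (Qˢ)ʳ → Pʳ → X`.
  · obtain ⟨r, hr, p, _⟩ := h X
    obtain ⟨s, hs, q, _, _⟩ := hQ.2.2 P hP.1
    refine ⟨r * s, Nat.mul_pos hr hs, (biproduct.whiskerEquiv
      (g := fun _ : Σ _ : Fin r, Fin s => Q)
      (((Equiv.sigmaEquivProd _ _).trans finProdFinEquiv).symm) fun _ => Iso.refl _).hom ≫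
      (biproductBiproductIso (fun _ : Fin r => Fin s) fun _ _ => Q).inv ≫
      biproduct.map (fun _ => q) ≫ p, inferInstance⟩

end

/-- Exact sequences `0 ⟶ Uᵢ ⟶ Pᵢ ⟶ Δᵢ ⟶ 0` with `Uᵢ` filtered by the `Δⱼ` for `i < j` and `Pᵢ`
relatively projective yield a projective generator of `Filt Δ`. -/
lemma isProjectiveGeneratorOf_biproduct {n : ℕ} {S : Fin n → ShortComplex C}
    (hS : ∀ i, (S i).ShortExact)
    (hU : ∀ i, IsFiltered (fun j : {j : Fin n // i < j} => (S j).X₃) (S i).X₁)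
    (hP : ∀ i, LiftsAgainst (fun i => (S i).X₃) (S i).X₂) :
    IsProjectiveGeneratorOf (Filt fun i => (S i).X₃) (⨁ fun i => (S i).X₂) := by
  have hU' i : IsFiltered (fun i => (S i).X₃) (S i).X₁ :=
    (hU i).mono fun j => .self (Δ := fun i => (S i).X₃) j.1
  have hP' i : IsFiltered (fun i => (S i).X₃) (S i).X₂ :=
    .of_shortExact' (hS i) (hU' i) (.self (Δ := fun i => (S i).X₃) i)
  have hl := LiftsAgainst.biproduct hP
  refine isProjectiveGeneratorOf_filt_iff.2 ⟨.biproduct hP', hl, fun X =>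
    HasCover.of_isFiltered (.biproduct hP') hl fun i => ?_⟩
  have := (hS i).epi_g
  -- The kernel of the projection is the sum of the other `Pⱼ`, that of `Pᵢ → Δᵢ` is `Uᵢ`; both are
  -- filtered.
  refine ⟨biproduct.π (fun i => (S i).X₂) i ≫ (S i).g, inferInstance, .kernel_comp _ _ ?_
    ((hU' i).of_iso ((hS i).fIsKernel.conePointUniqueUpToIso (limit.isLimit _)))⟩
  exact (IsFiltered.biproduct (f := Subtype.restrict (· ≠ i) fun i => (S i).X₂)
    fun j => hP' j).of_iso (kernelBiproductπIso _ i).symm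

/-! ### Vanishing of `Ext¹` and universal extensions. -/

section Ext

open Abelian

/-- The obstruction to lifting `f` is the pullback along `f` of the extension class, which lies in
`Ext¹(X, S.X₁)`. -/
lemma ExtOneVanishes.exists_lift {X : C} {S : ShortComplex C} (hS : S.ShortExact)
    (h : ExtOneVanishes X S.X₁) (f : X ⟶ S.X₃) : ∃ g : X ⟶ S.X₂, g ≫ S.g = f := by
  let _ : HasExt.{max u v} C := HasExt.standard C
  have : Subsingleton (Ext X S.X₁ 1) := h
  obtain ⟨x, hx⟩ := Ext.covariant_sequence_exact₃ X hS (Ext.mk₀ f) (zero_add 1)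
    (Subsingleton.elim _ _)
  obtain ⟨g, rfl⟩ := (Ext.mk₀_bijective X S.X₂).2 x
  rw [Ext.mk₀_comp_mk₀] at hx
  exact ⟨g, (Ext.mk₀_bijective X S.X₃).1 hx⟩

lemma extOneVanishes_of_projective (P Y : C) [Projective P] : ExtOneVanishes P Y := by
  let _ : HasExt.{max u v} C := HasExt.standard C
  exact Ext.subsingleton_of_projective P Y 0

lemma ExtOneVanishes.of_shortExact_right {X : C} {S : ShortComplex C} (hS : S.ShortExact)
    (h₁ : ExtOneVanishes X S.X₁) (h₃ : ExtOneVanishes X S.X₃) : ExtOneVanishes X S.X₂ := by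
  let _ : HasExt.{max u v} C := HasExt.standard C
  have : Subsingleton (Ext X S.X₁ 1) := h₁
  have : Subsingleton (Ext X S.X₃ 1) := h₃
  refine subsingleton_of_forall_eq (0 : Ext X S.X₂ 1) fun x => ?_
  obtain ⟨y, rfl⟩ := Ext.covariant_sequence_exact₂ X hS x (Subsingleton.elim _ _)
  rw [Subsingleton.elim y 0, Ext.zero_comp]

lemma ExtOneVanishes.of_shortExact_left {Y : C} {S : ShortComplex C} (hS : S.ShortExact)
    (h₁ : ExtOneVanishes S.X₁ Y) (h₃ : ExtOneVanishes S.X₃ Y) : ExtOneVanishes S.X₂ Y := by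
  let _ : HasExt.{max u v} C := HasExt.standard C
  have : Subsingleton (Ext S.X₁ Y 1) := h₁
  have : Subsingleton (Ext S.X₃ Y 1) := h₃
  refine subsingleton_of_forall_eq (0 : Ext S.X₂ Y 1) fun x => ?_
  obtain ⟨y, rfl⟩ := Ext.contravariant_sequence_exact₂ hS Y x (Subsingleton.elim _ _)
  rw [Subsingleton.elim y 0, Ext.comp_zero]

/-- If every morphism `S.X₁ ⟶ Y` is zero, then `Ext¹(S.X₃, Y)` embeds into `Ext¹(S.X₂, Y)`. -/
lemma ExtOneVanishes.of_hom_eq_zero {Y : C} {S : ShortComplex C} (hS : S.ShortExact)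
    (h₁ : ∀ f : S.X₁ ⟶ Y, f = 0) (h₂ : ExtOneVanishes S.X₂ Y) :
    ExtOneVanishes S.X₃ Y := by
  let _ : HasExt.{max u v} C := HasExt.standard C
  have : Subsingleton (Ext S.X₂ Y 1) := h₂
  refine subsingleton_of_forall_eq (0 : Ext S.X₃ Y 1) fun x => ?_
  obtain ⟨y, rfl⟩ := Ext.contravariant_sequence_exact₃ hS Y x (Subsingleton.elim _ _)
    (add_zero 1)
  obtain ⟨f, rfl⟩ := (Ext.mk₀_bijective S.X₁ Y).2 y
  rw [h₁ f, Ext.mk₀_zero, Ext.comp_zero]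

lemma ExtOneVanishes.of_iso {X X' Y Y' : C} (h : ExtOneVanishes X Y) (e : X ≅ X') (e' : Y ≅ Y') :
    ExtOneVanishes X' Y' := by
  let _ : HasExt.{max u v} C := HasExt.standard C
  have : Subsingleton (Ext X Y 1) := h
  refine subsingleton_of_forall_eq (0 : Ext X' Y' 1) fun x => ?_
  have hx : ((Ext.mk₀ e.hom).comp x (zero_add 1)).comp (Ext.mk₀ e'.inv) (add_zero 1) = 0 :=
    Subsingleton.elim (α := Ext X Y 1) _ _
  have hx' := congrArg (fun y => ((Ext.mk₀ e.inv).comp y (zero_add 1)).comp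
    (Ext.mk₀ e'.hom) (add_zero 1)) hx
  simp only [Ext.comp_assoc_of_third_deg_zero, Ext.comp_zero, Ext.zero_comp,
    Ext.mk₀_comp_mk₀_assoc, Ext.mk₀_comp_mk₀, e.inv_hom_id, e'.inv_hom_id, Ext.mk₀_id_comp,
    Ext.comp_mk₀_id] at hx'
  exact hx'

lemma ExtOneVanishes.of_isZero_left {X : C} (h : IsZero X) (Y : C) : ExtOneVanishes X Y :=
  have := h.projective
  extOneVanishes_of_projective X Y

lemma ExtOneVanishes.of_isZero_right (X : C) {Y : C} (h : IsZero Y) : ExtOneVanishes X Y := by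
  let _ : HasExt.{max u v} C := HasExt.standard C
  refine subsingleton_of_forall_eq (0 : Ext X Y 1) fun x => ?_
  rw [← Ext.comp_mk₀_id x, (IsZero.iff_id_eq_zero Y).1 h, Ext.mk₀_zero, Ext.comp_zero]

/-- The pushout of a short exact sequence along a morphism from its first term is short exact. -/
lemma shortExact_of_isPushout {S : ShortComplex C} (hS : S.ShortExact) {Z E : C} {f : S.X₁ ⟶ Z}
    {a : S.X₂ ⟶ E} {b : Z ⟶ E} (sq : IsPushout S.f f a b) {g : E ⟶ S.X₃} (hg : a ≫ g = S.g)
    (w : b ≫ g = 0) : (ShortComplex.mk b g w).ShortExact := by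
  have := hS.mono_f
  have := hS.epi_g
  have : Epi g := epi_of_epi_fac hg
  have : Mono b := Abelian.mono_inr_of_isColimit (f := S.f) (g := f) sq.isColimit
  refine .mk' (ShortComplex.exact_of_g_is_cokernel _ (CokernelCofork.IsColimit.ofπ _ _
    (fun {W} k hk => hS.exact.desc (a ≫ k) ?_) (fun k hk => ?_)
    (fun k hk m hm => ?_))) inferInstance inferInstance
  · dsimp at hk
    rw [← Category.assoc, sq.w, Category.assoc, hk, comp_zero]
  · dsimp at hk ⊢
    refine sq.hom_ext ?_ ?_
    · rw [← Category.assoc, hg, hS.exact.g_desc]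
    · rw [← Category.assoc, w, zero_comp, hk]
  · dsimp at hk hm ⊢
    rw [← cancel_epi S.g, hS.exact.g_desc, ← hm, ← Category.assoc, hg]

/-- Let `0 ⟶ K ⟶ F ⟶ X ⟶ 0` be exact with `Ext¹(F, Y) = 0`, and let `f : K ⟶ Z` be a morphism
through which all morphisms `K ⟶ Y` factor. If `Ext¹(Z, Y) = 0`, then `Ext¹(-, Y)` vanishes on the
middle term of the extension of `X` by `Z` obtained as pushout along `f`. -/
lemma ExtOneVanishes.of_isPushout {S : ShortComplex C} (hS : S.ShortExact) {Y Z E : C}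
    (hF : ExtOneVanishes S.X₂ Y) {f : S.X₁ ⟶ Z} (hf : ∀ g : S.X₁ ⟶ Y, ∃ h, f ≫ h = g)
    {a : S.X₂ ⟶ E} {b : Z ⟶ E} (sq : IsPushout S.f f a b) {g : E ⟶ S.X₃} (hg : a ≫ g = S.g)
    (w : b ≫ g = 0) (hZ : ExtOneVanishes Z Y) : ExtOneVanishes E Y := by
  let _ : HasExt.{max u v} C := HasExt.standard C
  have hT := shortExact_of_isPushout hS sq hg w
  let φ : S ⟶ ShortComplex.mk b g w :=
    { τ₁ := f, τ₂ := a, τ₃ := 𝟙 _, comm₁₂ := sq.w.symm, comm₂₃ := by simp [hg] }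
  have : Subsingleton (Ext S.X₂ Y 1) := hF
  have : Subsingleton (Ext Z Y 1) := hZ
  refine subsingleton_of_forall_eq (0 : Ext E Y 1) fun x => ?_
  -- The class restricts to zero on `Z`, so it comes from `y` on `S.X₃`. As `y` dies on `S.X₂`, it
  -- is the class of `S` pushed along some `k = f ≫ h`, that is, the class of the pushout sequence
  -- pushed along `h`. Such a class becomes zero on `E`.
  obtain ⟨y, rfl⟩ := Ext.contravariant_sequence_exact₂ hT Y x (Subsingleton.elim (α := Ext Z Y 1) _ _)
  obtain ⟨z, hz⟩ := Ext.contravariant_sequence_exact₃ hS Y y (Subsingleton.elim _ _)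
    (add_zero 1)
  obtain ⟨k, rfl⟩ := (Ext.mk₀_bijective S.X₁ Y).2 z
  obtain ⟨h, rfl⟩ := hf k
  have hn : hS.extClass.comp (Ext.mk₀ f) (add_zero 1) = hT.extClass :=
    (ShortComplex.ShortExact.extClass_naturality hS hT φ).trans (Ext.mk₀_id_comp _)
  rw [← Ext.mk₀_comp_mk₀, ← Ext.comp_assoc_of_second_deg_zero, hn] at hz
  rw [← hz]
  exact hT.comp_extClass_assoc _ _

variable {ι : Type w} {Δ : ι → C}

lemma IsFiltered.extOneVanishes_right {X Y : C} (hY : IsFiltered Δ Y)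
    (h : ∀ j, ExtOneVanishes X (Δ j)) : ExtOneVanishes X Y := by
  induction hY with
  | of_isZero hY => exact .of_isZero_right X hY
  | of_shortExact hS _ j e ih =>
    exact .of_shortExact_right hS ih ((h j).of_iso (Iso.refl _) e.some.symm)

lemma IsFiltered.extOneVanishes_left {X Y : C} (hX : IsFiltered Δ X)
    (h : ∀ j, ExtOneVanishes (Δ j) Y) : ExtOneVanishes X Y := by
  induction hX with
  | of_isZero hX => exact .of_isZero_left hX Y
  | of_shortExact hS _ j e ih =>
    exact .of_shortExact_left hS ih ((h j).of_iso e.some.symm (Iso.refl _))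

lemma IsFiltered.hom_eq_zero {X Y : C} (hX : IsFiltered Δ X)
    (h : ∀ j, ∀ f : Δ j ⟶ Y, f = 0) (f : X ⟶ Y) : f = 0 := by
  induction hX with
  | of_isZero hX => exact hX.eq_of_src _ _
  | @of_shortExact S hS _ j e ih =>
    have := hS.epi_g
    obtain ⟨e⟩ := e
    have hd := hS.exact.g_desc f (ih _)
    rw [← hd, ← e.hom_inv_id_assoc (hS.exact.desc f (ih _)), h j (e.inv ≫ _), comp_zero, comp_zero]

/-- Dévissage on the kernel term alone turns `Ext¹`-vanishing against each `Δ j` into relative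
projectivity. -/
lemma liftsAgainst_of_extOneVanishes {P : C} (h : ∀ j, ExtOneVanishes P (Δ j)) :
    LiftsAgainst Δ P :=
  fun _ hS h₁ _ _ f => (h₁.extOneVanishes_right h).exists_lift hS f

variable (C) in
/-- For all `X` and `Y`, every morphism `X ⟶ Y` factors through one fixed morphism from `X` to a
finite power of `Y`. -/
def HasFiniteLeftApproximations : Prop :=
  ∀ X Y : C, ∃ (m : ℕ) (f : X ⟶ ⨁ fun _ : Fin m => Y), ∀ g : X ⟶ Y, ∃ h, f ≫ h = g

/-- The universal extension of `E` by a finite power of `Y`. -/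
lemma exists_universal_extension [EnoughProjectives C] (hC : HasFiniteLeftApproximations C)
    (E Y : C) (hY : ExtOneVanishes Y Y) : ∃ (E' : C) (g : E' ⟶ E) (m : ℕ),
      Epi g ∧ Nonempty (kernel g ≅ ⨁ fun _ : Fin m => Y) ∧ ExtOneVanishes E' Y := by
  -- The universal extension is the pushout of a projective presentation of `E` along an
  -- approximation of its syzygy by a power of `Y`; no generators of `Ext¹(E, Y)` are chosen.
  have hS := shortExact_kernel (Projective.π E)
  obtain ⟨m, f, hf⟩ := hC (kernel (Projective.π E)) Y
  have sq := IsPushout.of_hasPushout (kernel.ι (Projective.π E)) f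
  let g := sq.desc (Projective.π E) 0 (by simp)
  have hg : pushout.inl _ f ≫ g = Projective.π E := sq.inl_desc _ _ _
  have w : pushout.inr _ f ≫ g = 0 := sq.inr_desc _ _ _
  have hT := shortExact_of_isPushout hS sq hg w
  refine ⟨_, g, m, hT.epi_g,
    ⟨IsLimit.conePointUniqueUpToIso (limit.isLimit _) hT.fIsKernel⟩, ?_⟩
  refine .of_isPushout hS (extOneVanishes_of_projective _ _) hf sq hg w ?_
  exact (IsFiltered.biproduct fun _ => .self (Δ := fun _ : Unit => Y) ()).extOneVanishes_left
    fun _ => hY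

/-- Iterated universal extensions of `Δ i` by the `Δ j` with `i < j`. -/
lemma exists_epi_of_extOneVanishes [EnoughProjectives C] (hC : HasFiniteLeftApproximations C)
    {n : ℕ} {Δ : Fin n → C} (hΔ : ∀ i j, j ≤ i → ExtOneVanishes (Δ i) (Δ j)) (i : Fin n) :
    ∃ (P : C) (g : P ⟶ Δ i), Epi g ∧
      IsFiltered (fun j : {j : Fin n // i < j} => Δ j) (kernel g) ∧
      ∀ j, ExtOneVanishes P (Δ j) := by
  -- `m` bounds the indices `j` already treated; at `m = i + 1` the object `Δ i` itself works.
  suffices key : ∀ m : ℕ, i.val + 1 ≤ m → m ≤ n → ∃ (P : C) (g : P ⟶ Δ i), Epi g ∧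
      IsFiltered (fun j : {j : Fin n // i < j} => Δ j) (kernel g) ∧
      ∀ j : Fin n, j.val < m → ExtOneVanishes P (Δ j) by
    obtain ⟨P, g, h₁, h₂, h₃⟩ := key n i.isLt le_rfl
    exact ⟨P, g, h₁, h₂, fun j => h₃ j j.isLt⟩
  intro m hm
  induction m, hm using Nat.le_induction with
  | base =>
    intro _
    exact ⟨Δ i, 𝟙 _, inferInstance, .of_isZero ((isZero_zero C).of_iso (kernel.ofMono _)),
      fun j hj => hΔ i j (Fin.le_def.2 (by omega))⟩
  | succ m hm ih =>
    intro hmn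
    obtain ⟨P, g, _, hg, hP⟩ := ih (by omega)
    let k : Fin n := ⟨m, by omega⟩
    have hik : i < k := Fin.lt_def.2 hm
    obtain ⟨E, p, r, _, ⟨e⟩, hE⟩ := exists_universal_extension hC P (Δ k) (hΔ k k le_rfl)
    have hr : IsFiltered (fun j : {j : Fin n // i < j} => Δ j) (⨁ fun _ : Fin r => Δ k) :=
      .biproduct fun _ => .self (Δ := fun j : {j : Fin n // i < j} => Δ j) ⟨k, hik⟩
    refine ⟨E, p ≫ g, inferInstance, .kernel_comp _ _ (hr.of_iso e.symm) hg, fun j hj => ?_⟩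
    by_cases hjm : j.val < m
    -- Earlier vanishing persists: the new kernel is a power of `Δ k`, and `Ext¹(Δ k, Δ j) = 0`
    -- since `j < k`.
    · refine .of_shortExact_left (shortExact_kernel p) ?_ (hP j hjm)
      exact (IsFiltered.biproduct fun _ => .self (Δ := fun _ : Unit => Δ k) ()).extOneVanishes_left
        (fun _ => hΔ k j (Fin.le_def.2 hjm.le)) |>.of_iso e.symm (Iso.refl _)
    · obtain rfl : j = k := Fin.ext (by dsimp [k]; omega)
      exact hE

end Ext

/-! ### Finiteness of the set of simple objects. -/

section Simples

/-- A simple quotient of an object with a finite filtration with simple factors is isomorphic to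
one of the factors. -/
lemma IsFiltered.exists_iso_of_simple {ι : Type w} {Δ : ι → C} (hΔ : ∀ j, Simple (Δ j)) {X T : C}
    (hX : IsFiltered Δ X) [Simple T] {f : X ⟶ T} (hf : f ≠ 0) : ∃ j, Nonempty (T ≅ Δ j) := by
  induction hX with
  | of_isZero hX => exact (hf (hX.eq_of_src _ _)).elim
  | @of_shortExact S hS _ j e ih =>
    -- Either `f` factors through the simple quotient, giving an isomorphism by Schur, or it is
    -- nonzero on the subobject.
    by_cases h : S.f ≫ f = 0
    · obtain ⟨e⟩ := e
      have := hΔ j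
      have := Simple.of_iso e
      have := hS.epi_g
      have hd := hS.exact.g_desc f h
      have hd0 : hS.exact.desc f h ≠ 0 := fun h0 => hf (by rw [← hd, h0, comp_zero])
      have := isIso_of_hom_simple hd0
      exact ⟨j, ⟨(asIso (hS.exact.desc f h)).symm ≪≫ e⟩⟩
    · exact ih h

/-- An abelian category with a projective generator of finite length has only finitely many
isomorphism classes of simple objects. -/
lemma IsProjectiveGenerator.finite_simples {P : C} (hP : IsProjectiveGenerator P)
    (h : HasCompositionSeries P) :
    ∃ (m : ℕ) (T : Fin m → C), ∀ X : C, Simple X → ∃ i, Nonempty (X ≅ T i) := by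
  obtain ⟨t, F, h0, ht, hF⟩ := h
  -- Only the `t` factors of one fixed composition series of `P` are needed to represent all simple
  -- objects.
  choose S hS using fun i : Fin t => hF i i.2
  have hf : Filt (fun i : Fin t => (S i).1) P :=
    ⟨t, F, h0, ht, fun i hi => ⟨⟨i, hi⟩, hS ⟨i, hi⟩⟩⟩
  refine ⟨t, fun i : Fin t => (S i).1, fun X _ => ?_⟩
  obtain ⟨r, _, p, _⟩ := (isProjectiveGenerator_iff.1 hP).2 X
  obtain ⟨a, ha⟩ : ∃ a, biproduct.ι (fun _ : Fin r => P) a ≫ p ≠ 0 := by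
    by_contra! hc
    have hp : p = 0 := by ext a; simp [hc]
    refine Simple.not_isZero X ((IsZero.iff_id_eq_zero X).2 ?_)
    rw [← cancel_epi p, hp, zero_comp, zero_comp]
  exact hf.isFiltered.exists_iso_of_simple (fun i => (S i).2) ha

end Simples

/-! ### Both implications for abelian categories. -/

section Main

variable {n : ℕ}

/-- `Uᵢ` is filtered by `Δₗ` with `l > i ≥ j`, so `Hom(Uᵢ, Δⱼ) = 0`, and `Ext¹(Pᵢ, Δⱼ) = 0` as `Pᵢ`
is a summand of a projective. -/
lemma extOneVanishes_of_sequences {S : Fin n → ShortComplex C}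
    (hS : ∀ i, (S i).ShortExact) (hH : ∀ i j, j < i → ∀ f : (S i).X₃ ⟶ (S j).X₃, f = 0)
    (hU : ∀ i, Filt (fun j : {j : Fin n // i < j} => (S j).X₃) (S i).X₁)
    (hP : Projective (⨁ fun i => (S i).X₂)) (i j : Fin n) (hij : j ≤ i) :
    ExtOneVanishes (S i).X₃ (S j).X₃ := by
  have : Projective (S i).X₂ :=
    (Retract.mk (biproduct.ι (fun i => (S i).X₂) i) (biproduct.π _ i) (by simp)).projective
  exact .of_hom_eq_zero (hS i) ((hU i).isFiltered.hom_eq_zero fun l => hH l j (hij.trans_lt l.2))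
    (extOneVanishes_of_projective _ _)

lemma isProjectiveGeneratorOf_of_sequences {S : Fin n → ShortComplex C}
    (hS : ∀ i, (S i).ShortExact)
    (hU : ∀ i, Filt (fun j : {j : Fin n // i < j} => (S j).X₃) (S i).X₁)
    (hP : Projective (⨁ fun i => (S i).X₂)) :
    IsProjectiveGeneratorOf (Filt fun i => (S i).X₃) (⨁ fun i => (S i).X₂) := by
  refine isProjectiveGeneratorOf_biproduct hS (fun i => (hU i).isFiltered) fun i =>
    liftsAgainst_of_extOneVanishes fun j => ?_
  have : Projective (S i).X₂ :=
    (Retract.mk (biproduct.ι (fun i => (S i).X₂) i) (biproduct.π _ i) (by simp)).projective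
  exact extOneVanishes_of_projective _ _

variable (C) in
lemma IsHighestWeightCategory.exists_standard (h : IsHighestWeightCategory C) :
    ∃ (n : ℕ) (Δ : Fin n → C), (∀ i, EndIsDivisionRing (Δ i)) ∧
      (∀ i j, j < i → ∀ f : Δ i ⟶ Δ j, f = 0) ∧ (∀ i j, j ≤ i → ExtOneVanishes (Δ i) (Δ j)) ∧
      (∃ P, IsProjectiveGeneratorOf (Filt Δ) P ∧ IsProjectiveGenerator P) ∧
      ∀ P, IsProjectiveGeneratorOf (Filt Δ) P → IsProjectiveGenerator P := by
  obtain ⟨n, S, hS, hE, hH, hU, hP⟩ := h.exists_sequences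
  have hF := isProjectiveGeneratorOf_of_sequences hS hU hP.1
  exact ⟨n, fun i => (S i).X₃, hE, hH, extOneVanishes_of_sequences hS hH hU hP.1,
    ⟨_, hF, hP⟩, fun Q hQ => hP.of_filt hF hQ⟩

/-- Standard objects form a standardizable set: `Filt Δ` has a projective generator that is the sum
of the middle terms of suitable exact sequences. -/
lemma exists_sequences_of_standard [EnoughProjectives C] (hC : HasFiniteLeftApproximations C)
    {Δ : Fin n → C} (hΔ : ∀ i j, j ≤ i → ExtOneVanishes (Δ i) (Δ j)) :
    ∃ (U P : Fin n → C) (f : ∀ i, U i ⟶ P i) (g : ∀ i, P i ⟶ Δ i) (w : ∀ i, f i ≫ g i = 0),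
      (∀ i, (ShortComplex.mk (f i) (g i) (w i)).ShortExact) ∧
      (∀ i, Filt (fun j : {j : Fin n // i < j} => Δ j) (U i)) ∧
      IsProjectiveGeneratorOf (Filt Δ) (⨁ P) := by
  choose P g hg hU hE using exists_epi_of_extOneVanishes hC hΔ
  have hS i := shortExact_kernel (g i)
  exact ⟨fun i => kernel (g i), P, fun i => kernel.ι (g i), g, fun i => kernel.condition _, hS,
    fun i => (hU i).filt, isProjectiveGeneratorOf_biproduct hS hU
    fun i => liftsAgainst_of_extOneVanishes (hE i)⟩

/-- Under (4), comparison with the given generator shows that `⨁ P` generates the whole category;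
(4') applies to `⨁ P` directly. -/
lemma isHighestWeightCategory_of_standard [EnoughProjectives C]
    (hC : HasFiniteLeftApproximations C) (hl : ∀ X : C, HasCompositionSeries X) {Δ : Fin n → C}
    (hE : ∀ i, EndIsDivisionRing (Δ i)) (hH : ∀ i j, j < i → ∀ f : Δ i ⟶ Δ j, f = 0)
    (hΔ : ∀ i j, j ≤ i → ExtOneVanishes (Δ i) (Δ j))
    (hP : (∃ P, IsProjectiveGeneratorOf (Filt Δ) P ∧ IsProjectiveGenerator P) ∨
      ∀ P, IsProjectiveGeneratorOf (Filt Δ) P → IsProjectiveGenerator P) :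
    IsHighestWeightCategory C := by
  obtain ⟨U, P, f, g, w, hS, hU, hF⟩ := exists_sequences_of_standard hC hΔ
  have hG : IsProjectiveGenerator (⨁ P) := by
    obtain ⟨Q, hQ, hQ'⟩ | h := hP
    · exact hQ'.of_filt hQ hF
    · exact h _ hF
  exact ⟨hl, hG.finite_simples (hl _), n, fun i => .mk (f i) (g i) (w i), hS, hE, hH, hU, hG⟩

end Main

/-! ### Finitely generated modules over an artin algebra. -/

section FGModuleCat

variable (R : Type u) [Ring R] [IsNoetherianRing R]

lemma FGModuleCat.epi_iff_surjective {X Y : FGModuleCat.{u} R} (f : X ⟶ Y) :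
    Epi f ↔ Function.Surjective f.hom.hom := by
  rw [← ModuleCat.epi_iff_surjective]
  exact ⟨fun _ => inferInstanceAs (Epi ((forget₂ (FGModuleCat.{u} R) (ModuleCat.{u} R)).map f)),
    fun h => (forget₂ (FGModuleCat.{u} R) (ModuleCat.{u} R)).epi_of_epi_map h⟩

lemma FGModuleCat.shortExact_submodule (M : Type u) [AddCommGroup M] [Module R M]
    [Module.Finite R M] (N : Submodule R M) :
    (ShortComplex.mk (FGModuleCat.ofHom N.subtype) (FGModuleCat.ofHom N.mkQ) (by
      ext x; exact (Submodule.Quotient.mk_eq_zero N).2 x.2)).ShortExact := by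
  have h₁ : Mono (FGModuleCat.ofHom N.subtype) :=
    (forget₂ (FGModuleCat.{u} R) (ModuleCat.{u} R)).mono_of_mono_map
      ((ModuleCat.mono_iff_injective _).2 N.subtype_injective)
  have h₂ : Epi (FGModuleCat.ofHom N.mkQ) :=
    (FGModuleCat.epi_iff_surjective R _).2 N.mkQ_surjective
  refine .mk' ?_ h₁ h₂
  rw [← ShortComplex.exact_map_iff_of_faithful _ (forget₂ (FGModuleCat.{u} R) (ModuleCat.{u} R)),
    ShortComplex.ShortExact.moduleCat_exact_iff_function_exact]
  exact LinearMap.exact_subtype_mkQ N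

instance FGModuleCat.enoughProjectives : EnoughProjectives (FGModuleCat.{u} R) where
  presentation X := by
    obtain ⟨n, f, hf⟩ := Module.Finite.exists_fin' R X
    have : Projective (FGModuleCat.of R (Fin n → R)) := by
      refine ⟨fun {E Y} g e _ => ?_⟩
      obtain ⟨l, hl⟩ := Module.projective_lifting_property e.hom.hom g.hom.hom
        ((FGModuleCat.epi_iff_surjective R e).1 ‹_›)
      exact ⟨FGModuleCat.ofHom l, FGModuleCat.hom_ext hl⟩
    exact ⟨{ p := FGModuleCat.of R (Fin n → R)
             f := FGModuleCat.ofHom f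
             epi := (FGModuleCat.epi_iff_surjective R _).2 hf }⟩

lemma FGModuleCat.simple_of_isSimpleModule (M : Type u) [AddCommGroup M] [Module R M]
    [Module.Finite R M] [IsSimpleModule R M] : Simple (FGModuleCat.of R M) := by
  have : Simple ((forget₂ (FGModuleCat.{u} R) (ModuleCat.{u} R)).obj (FGModuleCat.of R M)) :=
    inferInstanceAs (Simple (ModuleCat.of R M))
  exact (forget₂ (FGModuleCat.{u} R) (ModuleCat.{u} R)).simple_of_simple_obj (FGModuleCat.of R M)

/-- Finiteness is quantified after the colon because the module varies in the induction on length.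
-/
lemma FGModuleCat.isFiltered_of_isFiniteLength {M : Type u} [AddCommGroup M] [Module R M]
    (h : IsFiniteLength R M) : ∀ _ : Module.Finite R M,
    IsFiltered (fun S : {S : FGModuleCat.{u} R // Simple S} => S.1) (FGModuleCat.of R M) := by
  induction h with
  | of_subsingleton =>
    intro _
    refine .of_isZero ((IsZero.iff_id_eq_zero _).2 ?_)
    ext x
    exact Subsingleton.elim _ _
  | @of_simple_quotient M _ _ N _ _ ih =>
    intro _
    exact .of_shortExact (FGModuleCat.shortExact_submodule R M N) (ih inferInstance)
      ⟨_, FGModuleCat.simple_of_isSimpleModule R (M ⧸ N)⟩ ⟨Iso.refl _⟩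

lemma FGModuleCat.hasCompositionSeries [IsArtinianRing R] (X : FGModuleCat.{u} R) :
    HasCompositionSeries X :=
  (FGModuleCat.isFiltered_of_isFiniteLength R (M := X)
    (isFiniteLength_iff_isNoetherian_isArtinian.2 ⟨inferInstance, inferInstance⟩) inferInstance).filt

/-- Evaluation at finitely many generators of `X` embeds `Hom(X, Y)` into a power of `Y`, so it is
finite over the noetherian ring `k`. A finite generating set of it is the required approximation. -/
lemma FGModuleCat.hasFiniteLeftApproximations (k : Type w) [CommRing k] [IsNoetherianRing k]
    [Algebra k R] [Module.Finite k R] : HasFiniteLeftApproximations (FGModuleCat.{u} R) := by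
  intro X Y
  let _ : Module k Y := Module.compHom Y (algebraMap k R)
  have : IsScalarTower k R Y := .of_algebraMap_smul fun _ _ => rfl
  have : Module.Finite k Y := .trans R Y
  obtain ⟨n, s, hs⟩ := Module.Finite.exists_fin (R := R) (M := X)
  let ev : (X →ₗ[R] Y) →ₗ[k] (Fin n → Y) :=
    { toFun := fun φ i => φ (s i), map_add' := fun _ _ => rfl, map_smul' := fun _ _ => rfl }
  have hev : Function.Injective ev := fun φ ψ h =>
    LinearMap.ext_on_range hs (fun i => congrFun h i)
  have : Module.Finite k (X →ₗ[R] Y) := .of_injective ev hev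
  obtain ⟨m, f, hf⟩ := Module.Finite.exists_fin (R := k) (M := X →ₗ[R] Y)
  refine ⟨m, biproduct.lift fun i => FGModuleCat.ofHom (f i), fun g => ?_⟩
  obtain ⟨c, hc⟩ := (Submodule.mem_span_range_iff_exists_fun k).1
    (hf ▸ Submodule.mem_top : g.hom.hom ∈ Submodule.span k (Set.range f))
  -- Elements of `k` act on `Y` by `R`-linear maps, so the coefficients in `g = ∑ cᵢ fᵢ` give the
  -- second factor.
  refine ⟨biproduct.desc fun i => FGModuleCat.ofHom (c i • (LinearMap.id : Y →ₗ[R] Y)), ?_⟩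
  let φ : (X →ₗ[R] Y) →+ (X ⟶ Y) :=
    { toFun := FGModuleCat.ofHom, map_zero' := rfl, map_add' := fun _ _ => rfl }
  calc _ = ∑ i, φ (c i • f i) := biproduct.lift_desc
    _ = g := by rw [← map_sum, hc]; rfl

end FGModuleCat

end

end HighestWeight

/-- `Λ` is an artin algebra over the commutative artinian ring `k`, and `FGModuleCat Λᵐᵒᵖ` is the
category of finitely generated right `Λ`-modules. -/
theorem mainTheorem3 (k : Type w) (Λ : Type u) [CommRing k] [IsArtinianRing k] [Ring Λ]
    [Algebra k Λ] [Module.Finite k Λ] :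
    haveI : IsNoetherianRing Λᵐᵒᵖ := HighestWeight.isNoetherianRing_op k Λ
    (HighestWeight.IsHighestWeightCategory (FGModuleCat.{u} Λᵐᵒᵖ) ↔
      ∃ (n : ℕ) (Δ : Fin n → FGModuleCat.{u} Λᵐᵒᵖ),
        (∀ i, HighestWeight.EndIsDivisionRing (Δ i)) ∧
        (∀ i j, j < i → ∀ f : Δ i ⟶ Δ j, f = 0) ∧
        (∀ i j, j ≤ i → HighestWeight.ExtOneVanishes (Δ i) (Δ j)) ∧
        (∃ P, HighestWeight.IsProjectiveGeneratorOf (HighestWeight.Filt Δ) P ∧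
          HighestWeight.IsProjectiveGenerator P)) ∧
    (HighestWeight.IsHighestWeightCategory (FGModuleCat.{u} Λᵐᵒᵖ) ↔
      ∃ (n : ℕ) (Δ : Fin n → FGModuleCat.{u} Λᵐᵒᵖ),
        (∀ i, HighestWeight.EndIsDivisionRing (Δ i)) ∧
        (∀ i j, j < i → ∀ f : Δ i ⟶ Δ j, f = 0) ∧
        (∀ i j, j ≤ i → HighestWeight.ExtOneVanishes (Δ i) (Δ j)) ∧
        (∀ P, HighestWeight.IsProjectiveGeneratorOf (HighestWeight.Filt Δ) P →
          HighestWeight.IsProjectiveGenerator P)) := by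

  have : IsNoetherianRing Λᵐᵒᵖ := HighestWeight.isNoetherianRing_op k Λ
  have : IsArtinianRing Λᵐᵒᵖ := IsArtinianRing.of_finite k Λᵐᵒᵖ
  have hC := HighestWeight.FGModuleCat.hasFiniteLeftApproximations Λᵐᵒᵖ k
  have hl := HighestWeight.FGModuleCat.hasCompositionSeries Λᵐᵒᵖ
  refine ⟨⟨fun h => ?_, ?_⟩, ⟨fun h => ?_, ?_⟩⟩
  · obtain ⟨n, Δ, h₁, h₂, h₃, h₄, -⟩ := h.exists_standard
    exact ⟨n, Δ, h₁, h₂, h₃, h₄⟩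
  · rintro ⟨n, Δ, h₁, h₂, h₃, h₄⟩
    exact HighestWeight.isHighestWeightCategory_of_standard hC hl h₁ h₂ h₃ (.inl h₄)
  · obtain ⟨n, Δ, h₁, h₂, h₃, -, h₄⟩ := h.exists_standard
    exact ⟨n, Δ, h₁, h₂, h₃, h₄⟩
  · rintro ⟨n, Δ, h₁, h₂, h₃, h₄⟩
    exact HighestWeight.isHighestWeightCategory_of_standard hC hl h₁ h₂ h₃ (.inr h₄)
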